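/- Conventions. A parking function of length $n$ is a list $\alpha=(\alpha_1,\dots,\alpha_n)\in[n]^n$ such that, when cars $1,\dots,n$ arrive in order and car $i$ takes the first free spot at or after spot $\alpha_i$ on a one-way street with spots $1,\dots,n$, all cars can park. It is a unit interval parking function if every car $i$ parks in spot $\alpha_i$ or $\alpha_i+1$; $\mathrm{UPF}_n$ is the set of these ($\mathrm{UPF}_0$ consists of the empty list). Put $\mathrm{area}(\alpha)=\binom{n+1}{2}-\sum_i\alpha_i$. Let $\beta$ be the weakly increasing rearrangement of $\alpha\in\mathrm{UPF}_n$ and $i_1<\dots<i_k$ the positions $i$ with $\beta_i=i$; the blocks of $\alpha$ are $\pi_j=\beta_{i_j}\beta_{i_j+1}\cdots\beta_{i_{j+1}-1}$ (with $i_{k+1}=n+1$), and $\mathrm{con}(\alpha)=(|\pi_1|,\dots,|\pi_k|)$. The symmetric group $S_n$ acts on $\mathrm{UPF}_n$ as follows: the transposition $(i,i+1)$ fixes $\alpha$ if $\alpha_i,\alpha_{i+1}$ lie in the same block, and exchanges these two entries otherwise. This action preserves the area. Let $h_k$ and $p_k$ be the complete homogeneous and the power sum symmetric functions in $x_1,x_2,\dots$,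 with $h_0=p_0=1$; for $c=(c_1,\dots,c_\ell)$ let $h_c=h_{c_1}\cdots h_{c_\ell}$ and $\ell(c)=\ell$, and let $H(z)=\sum_{n\ge0}h_nz^n$. For an $S_n$-module $V$ with character $\chi$ let $\mathrm{ch}(V)=\frac1{n!}\sum_{\sigma\in S_n}\chi(\sigma)\,p_{\mathrm{cyc}(\sigma)}$, where $\mathrm{cyc}(\sigma)$ is the cycle type of $\sigma$. Define the area-graded Frobenius characteristic of $\mathbb{C}[\mathrm{UPF}_n]$ by $$\mathrm{UPF}_n(\mathbf{x},t)=\sum_{k\ge0}\mathrm{ch}\bigl(\mathbb{C}\{\alpha\in\mathrm{UPF}_n : \mathrm{area}(\alpha)=k\}\bigr)\,t^k .$$ Theorem. For every $n\ge0$, $$\mathrm{UPF}_n(\mathbf{x},t)=\sum_{\alpha}t^{\mathrm{area}(\alpha)}h_{\mathrm{con}(\alpha)}=\sum_{c\vDash n}t^{\,n-\ell(c)}h_c ,$$ where $\alpha$ runs over the weakly increasing elements of $\mathrm{UPF}_n$ and $c$ over the compositions of $n$. With $[2]_t=1+t$, the series $[2]_t-H(tz)$ is invertible in the ring of power series in $z$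 whose coefficients are Laurent polynomials in $t$ over the ring of formal power series $\mathbb{C}[[x_1,x_2,\dots]]$, and in that ring $$\sum_{n\ge0}\mathrm{UPF}_n(\mathbf{x},t)\,z^n=\frac{t}{[2]_t-H(tz)} .$$ -/

import Mathlib

open scoped Polynomial LaurentPolynomial

namespace UnitParking

/-! ### Unit interval parking functions

Cars and spots are indexed by `Fin n`, so that spot `s : Fin n` is the spot usually numbered
`s + 1`. -/

/-- `spot` records where the cars park when, in the order `0, 1, …`, every car `i` takes the first
spot that is at or after its preferred spot `α i` and is not occupied by an earlier car. -/
def IsParkingOutcome {n : ℕ} (α spot : Fin n → Fin n) : Prop :=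
  ∀ i, IsLeast {s | α i ≤ s ∧ ∀ j < i, spot j ≠ s} (spot i)

/-- All cars are able to park. -/
def IsParkingFunction {n : ℕ} (α : Fin n → Fin n) : Prop :=
  ∃ spot, IsParkingOutcome α spot

/-- All cars are able to park, and each car parks in its preferred spot or in the next one. -/
def IsUnitIntervalParkingFunction {n : ℕ} (α : Fin n → Fin n) : Prop :=
  ∃ spot, IsParkingOutcome α spot ∧ ∀ i, (spot i : ℕ) ≤ (α i : ℕ) + 1

/-- The set of unit interval parking functions of length `n`. -/
def UPF (n : ℕ) : Type := {α : Fin n → Fin n // IsUnitIntervalParkingFunction α}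

noncomputable instance (n : ℕ) : Fintype (UPF n) :=
  @Fintype.ofFinite _ (inferInstanceAs (Finite {_α : Fin n → Fin n // _}))

/-- `area α = binom(n+1, 2) - ∑ α_i`, where the preferences are numbered from `1`. The
subtraction does not truncate when `α` is a parking function. -/
def area {n : ℕ} (α : Fin n → Fin n) : ℕ :=
  (n + 1).choose 2 - ∑ i, ((α i : ℕ) + 1)

/-! ### Block structure

`Tuple.sort α` is the stable sorting permutation, so `β = α ∘ Tuple.sort α` is the weakly
increasing rearrangement of `α`, and the entry `α i` stands in `β` at position
`(Tuple.sort α).symm i`. A block of `β` starts at each position `s` with `β s = s`. -/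

/-- A block of the weakly increasing rearrangement of `α` starts at position `s`. -/
def IsBlockStart {n : ℕ} (α : Fin n → Fin n) (s : Fin n) : Prop :=
  α (Tuple.sort α s) = s

instance {n : ℕ} (α : Fin n → Fin n) : DecidablePred (IsBlockStart α) :=
  fun s => inferInstanceAs (Decidable (α (Tuple.sort α s) = s))

/-- The number `j` of the block `π_j`, numbered from `1`, that contains the entry `α i`. -/
def blockIndex {n : ℕ} (α : Fin n → Fin n) (i : Fin n) : ℕ :=
  (Finset.univ.filter fun s => IsBlockStart α s ∧ s ≤ (Tuple.sort α).symm i).card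

/-- The number of blocks. -/
def numBlocks {n : ℕ} (α : Fin n → Fin n) : ℕ :=
  (Finset.univ.filter fun s => IsBlockStart α s).card

/-- The content `(|π_1|, …, |π_k|)`, the list of block sizes. -/
def content {n : ℕ} (α : Fin n → Fin n) : List ℕ :=
  (List.range' 1 (numBlocks α)).map fun j => (Finset.univ.filter fun i => blockIndex α i = j).card

/-! ### The action of the symmetric group -/

/-- The rank of position `i` when the positions of the word `w` are ordered by their letters,
equal letters being ordered from left to right. -/
def standardize {n : ℕ} (w : Fin n → ℕ) (i : Fin n) : ℕ :=
  (Finset.univ.filter fun j => w j < w i ∨ (w j = w i ∧ j < i)).card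

theorem standardize_lt {n : ℕ} (w : Fin n → ℕ) (i : Fin n) : standardize w i < n := by
  have h : (Finset.univ.filter fun j => w j < w i ∨ (w j = w i ∧ j < i)).card
      < (Finset.univ : Finset (Fin n)).card := by
    apply Finset.card_lt_card
    rw [Finset.ssubset_univ_iff]
    intro h
    have := Finset.mem_univ i
    rw [← h] at this
    simp at this
  simpa [standardize] using h

/-- Replace the equal letters of `w`, from left to right, by the entries
`a, a, a + 1, a + 2, …` of one block, where `a` is the number of positions with smaller letters. -/
def fillBlocks {n : ℕ} (w : Fin n → ℕ) (i : Fin n) : Fin n :=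
  ⟨if ∃ j < i, w j = w i then standardize w i - 1 else standardize w i, by
    have := standardize_lt w i
    split_ifs <;> omega⟩

theorem standardize_lt_iff {n : ℕ} (w : Fin n → ℕ) (i j : Fin n) :
    standardize w i < standardize w j ↔ (w i < w j ∨ (w i = w j ∧ i < j)) := by
  have key : ∀ i j : Fin n, (w i < w j ∨ (w i = w j ∧ i < j)) →
      standardize w i < standardize w j := by
    intro i j h
    apply Finset.card_lt_card
    rw [Finset.ssubset_iff_of_subset]
    · refine ⟨i, by simpa using h, by simp⟩
    · intro k hk
      simp only [Finset.mem_filter, Finset.mem_univ, true_and] at hk ⊢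
      omega
  refine ⟨fun h => ?_, key i j⟩
  by_contra hc
  by_cases hij : i = j
  · subst hij; omega
  · have := key j i (by omega)
    omega

/-- `standardize` as a map between positions. -/
def stdFin {n : ℕ} (w : Fin n → ℕ) (i : Fin n) : Fin n := ⟨standardize w i, standardize_lt w i⟩

theorem stdFin_lt_iff {n : ℕ} (w : Fin n → ℕ) (i j : Fin n) :
    stdFin w i < stdFin w j ↔ (w i < w j ∨ (w i = w j ∧ i < j)) :=
  standardize_lt_iff w i j

theorem stdFin_injective {n : ℕ} (w : Fin n → ℕ) : Function.Injective (stdFin w) := by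
  intro i j h
  by_contra hij
  have h1 := stdFin_lt_iff w i j
  have h2 := stdFin_lt_iff w j i
  simp only [h, lt_self_iff_false, false_iff] at h1 h2
  omega

theorem fillBlocks_outcome {n : ℕ} (w : Fin n → ℕ) :
    IsParkingOutcome (fillBlocks w) (stdFin w) ∧
      ∀ i, (stdFin w i : ℕ) ≤ (fillBlocks w i : ℕ) + 1 := by
  refine ⟨fun i => ⟨⟨?_, fun j hj h => hj.ne (stdFin_injective w h)⟩, ?_⟩, fun i => ?_⟩
  · simp only [fillBlocks, stdFin, Fin.le_def]
    split_ifs <;> omega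
  · rintro s ⟨hs, hs'⟩
    by_contra hlt
    rw [not_le] at hlt
    obtain ⟨k, rfl⟩ := (Finite.injective_iff_surjective.1 (stdFin_injective w)) s
    have hk := (stdFin_lt_iff w k i).1 hlt
    have hki : ¬ k < i := fun h => hs' k h rfl
    simp only [fillBlocks, stdFin, Fin.le_def, Fin.lt_def] at hs hlt
    split_ifs at hs with hex
    · obtain ⟨l, hl, hwl⟩ := hex
      have h1 := (standardize_lt_iff w k l).2 (by omega)
      have h2 := (standardize_lt_iff w l i).2 (by omega)
      omega
    · omega
  · simp only [fillBlocks, stdFin]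
    split_ifs <;> omega

theorem isUPF_fillBlocks {n : ℕ} (w : Fin n → ℕ) :
    IsUnitIntervalParkingFunction (fillBlocks w) :=
  ⟨stdFin w, fillBlocks_outcome w⟩

theorem IsParkingOutcome.injective {n : ℕ} {α spot : Fin n → Fin n}
    (h : IsParkingOutcome α spot) : Function.Injective spot := by
  intro i j hij
  rcases lt_trichotomy i j with hlt | heq | hlt
  · exact absurd hij ((h j).1.2 i hlt)
  · exact heq
  · exact absurd hij.symm ((h i).1.2 j hlt)

theorem sort_symm_eq {n : ℕ} {α spot : Fin n → Fin n} (h : IsParkingOutcome α spot)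
    (hu : ∀ i, (spot i : ℕ) ≤ (α i : ℕ) + 1) (i : Fin n) : (Tuple.sort α).symm i = spot i := by
  let e : Equiv.Perm (Fin n) :=
    Equiv.ofBijective spot (Finite.injective_iff_bijective.1 h.injective)
  have he : ∀ p, spot (e.symm p) = p := fun p => e.apply_symm_apply p
  have hle : ∀ p, α (e.symm p) ≤ p := fun p => by
    have := (h (e.symm p)).1.1
    rwa [he] at this
  have hge : ∀ p : Fin n, (p : ℕ) ≤ (α (e.symm p) : ℕ) + 1 := fun p => by
    have := hu (e.symm p)
    rwa [he] at this
  have hs : e.symm = Tuple.sort α := by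
    rw [Tuple.eq_sort_iff]
    constructor
    · intro p q hpq
      rcases hpq.eq_or_lt with rfl | hlt
      · exact le_rfl
      · have h1 := hle p
        have h2 := hge q
        simp only [Function.comp, Fin.le_def, Fin.lt_def] at *
        omega
    · intro p q hpq heq
      have h1 := hle p
      have h2 := hge q
      by_contra hc
      have hpm : p ∈ {s | α (e.symm q) ≤ s ∧ ∀ j < e.symm q, spot j ≠ s} := by
        refine ⟨?_, ?_⟩
        · rw [← heq]; exact h1
        · intro j hj hjp
          apply hc
          have : j = e.symm p := h.injective (by rw [hjp, he])
          rwa [← this]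
      have := (h (e.symm q)).2 hpm
      rw [he] at this
      exact absurd hpq (not_lt.2 this)
  rw [← hs]
  rfl

/-- The structure of the weakly increasing rearrangement of a unit interval parking function. -/
theorem upf_structure {n : ℕ} {α : Fin n → Fin n} (h : IsUnitIntervalParkingFunction α)
    (p : Fin n) : IsBlockStart α p ∨ ∃ q : Fin n, (q : ℕ) + 1 = p ∧
      (α (Tuple.sort α p) : ℕ) + 1 = p ∧ Tuple.sort α q < Tuple.sort α p := by
  obtain ⟨spot, h, hu⟩ := h
  have he : ∀ p, spot (Tuple.sort α p) = p := fun p => by rw [← sort_symm_eq h hu]; simp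
  have h1 := (h (Tuple.sort α p)).1.1
  have h2 := hu (Tuple.sort α p)
  rw [he] at h1 h2
  by_cases hs : IsBlockStart α p
  · exact Or.inl hs
  · right
    have hne : (α (Tuple.sort α p) : ℕ) ≠ p := fun hh => hs (Fin.ext hh)
    rw [Fin.le_def] at h1
    refine ⟨α (Tuple.sort α p), by omega, by omega, ?_⟩
    by_contra hc
    have hm : α (Tuple.sort α p) ∈
        {s | α (Tuple.sort α p) ≤ s ∧ ∀ j < Tuple.sort α p, spot j ≠ s} := by
      refine ⟨le_rfl, fun j hj hjp => hc ?_⟩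
      have : j = Tuple.sort α (α (Tuple.sort α p)) := h.injective (by rw [hjp, he])
      rwa [← this]
    have := (h (Tuple.sort α p)).2 hm
    rw [he, Fin.le_def] at this
    omega

theorem blockIndex_mono {n : ℕ} (α : Fin n → Fin n) {p q : Fin n} (hpq : p ≤ q) :
    blockIndex α (Tuple.sort α p) ≤ blockIndex α (Tuple.sort α q) := by
  apply Finset.card_le_card
  intro s hs
  simp only [Finset.mem_filter, Finset.mem_univ, true_and, Equiv.symm_apply_apply] at hs ⊢
  exact ⟨hs.1, hs.2.trans hpq⟩

theorem blockIndex_lt {n : ℕ} (α : Fin n → Fin n) {p q : Fin n} (hpq : p < q)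
    (hq : IsBlockStart α q) :
    blockIndex α (Tuple.sort α p) < blockIndex α (Tuple.sort α q) := by
  apply Finset.card_lt_card
  rw [Finset.ssubset_iff_of_subset]
  · exact ⟨q, by simpa using hq, by simp [hpq]⟩
  · intro s hs
    simp only [Finset.mem_filter, Finset.mem_univ, true_and, Equiv.symm_apply_apply] at hs ⊢
    exact ⟨hs.1, hs.2.trans hpq.le⟩

theorem sort_lt_of_blockIndex_eq {n : ℕ} {α : Fin n → Fin n}
    (h : IsUnitIntervalParkingFunction α) (p : Fin n) (m : ℕ) :
    ∀ q : Fin n, (q : ℕ) = p + m + 1 →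
      blockIndex α (Tuple.sort α p) = blockIndex α (Tuple.sort α q) →
      Tuple.sort α p < Tuple.sort α q := by
  induction m with
  | zero =>
    intro q hq hb
    rcases upf_structure h q with hs | ⟨r, hr, -, hlt⟩
    · exact absurd hb (blockIndex_lt α (by rw [Fin.lt_def]; omega) hs).ne
    · have : r = p := Fin.ext (by omega)
      rwa [this] at hlt
  | succ m ih =>
    intro q hq hb
    rcases upf_structure h q with hs | ⟨r, hr, -, hlt⟩
    · exact absurd hb (blockIndex_lt α (by rw [Fin.lt_def]; omega) hs).ne
    · refine (ih r (by omega) (le_antisymm (blockIndex_mono α ?_) ?_)).trans hlt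
      · rw [Fin.le_def]; omega
      · rw [hb]; exact blockIndex_mono α (by rw [Fin.le_def]; omega)

theorem stdFin_blockIndex {n : ℕ} {α : Fin n → Fin n}
    (h : IsUnitIntervalParkingFunction α) :
    stdFin (blockIndex α) = (Tuple.sort α).symm := by
  have key : StrictMono fun p => stdFin (blockIndex α) (Tuple.sort α p) := by
    intro p q hpq
    rw [stdFin_lt_iff]
    rcases (blockIndex_mono α hpq.le).lt_or_eq with hlt | heq
    · exact Or.inl hlt
    · refine Or.inr ⟨heq, sort_lt_of_blockIndex_eq h p (q - p - 1) q ?_ heq⟩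
      rw [Fin.lt_def] at hpq
      omega
  funext i
  have := congrFun (key.range_inj strictMono_id |>.1 ?_) ((Tuple.sort α).symm i)
  · simpa using this
  · rw [Set.range_id, Set.range_eq_univ]
    exact Finite.injective_iff_surjective.1 key.injective

theorem fillBlocks_blockIndex {n : ℕ} {α : Fin n → Fin n}
    (h : IsUnitIntervalParkingFunction α) : fillBlocks (blockIndex α) = α := by
  funext i
  obtain ⟨p, rfl⟩ := (Tuple.sort α).surjective i
  have hstd : standardize (blockIndex α) (Tuple.sort α p) = p := by
    have := congrArg Fin.val (congrFun (stdFin_blockIndex h) (Tuple.sort α p))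
    simpa [stdFin] using this
  apply Fin.ext
  simp only [fillBlocks, hstd]
  rcases upf_structure h p with hs | ⟨q, hq, hα, hlt⟩
  · rw [if_neg, show α (Tuple.sort α p) = p from hs]
    rintro ⟨j, hj, hb⟩
    have h1 := (stdFin_lt_iff (blockIndex α) j (Tuple.sort α p)).2 (Or.inr ⟨hb, hj⟩)
    rw [stdFin_blockIndex h, Equiv.symm_apply_apply] at h1
    have h2 := blockIndex_lt α h1 hs
    rw [Equiv.apply_symm_apply] at h2
    omega
  · by_cases hs : IsBlockStart α p
    · have := congrArg Fin.val (show α (Tuple.sort α p) = p from hs)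
      omega
    · rw [if_pos]
      · omega
      · refine ⟨_, hlt, congrArg Finset.card (Finset.filter_congr fun s _ => ?_)⟩
        simp only [Equiv.symm_apply_apply, Fin.le_def]
        constructor
        · rintro ⟨h1, h2⟩
          exact ⟨h1, by omega⟩
        · rintro ⟨h1, h2⟩
          refine ⟨h1, ?_⟩
          have : (s : ℕ) ≠ p := fun hh => hs (Fin.ext hh ▸ h1)
          omega

theorem isBlockStart_fillBlocks {n : ℕ} (w : Fin n → ℕ) (k : Fin n) :
    IsBlockStart (fillBlocks w) (stdFin w k) ↔ ∀ j < k, w j ≠ w k := by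
  have hk : Tuple.sort (fillBlocks w) (stdFin w k) = k := by
    rw [← sort_symm_eq (fillBlocks_outcome w).1 (fillBlocks_outcome w).2]; simp
  rw [IsBlockStart, hk, Fin.ext_iff]
  simp only [fillBlocks, stdFin]
  split_ifs with hex
  · obtain ⟨j, hj, hw⟩ := hex
    have := (standardize_lt_iff w j k).2 (Or.inr ⟨hw, hj⟩)
    exact ⟨fun _ => by omega, fun hc => absurd hw (hc j hj)⟩
  · push Not at hex
    exact ⟨fun _ => hex, fun _ => rfl⟩

theorem blockIndex_fillBlocks {n : ℕ} (w : Fin n → ℕ) (i : Fin n) :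
    blockIndex (fillBlocks w) i =
      (Finset.univ.filter fun k => (∀ j < k, w j ≠ w k) ∧ w k ≤ w i).card := by
  symm
  apply Finset.card_bij (fun k _ => stdFin w k)
  · intro k hk
    simp only [Finset.mem_filter, Finset.mem_univ, true_and] at hk ⊢
    refine ⟨(isBlockStart_fillBlocks w k).2 hk.1, ?_⟩
    rw [sort_symm_eq (fillBlocks_outcome w).1 (fillBlocks_outcome w).2, ← not_lt, stdFin_lt_iff]
    have := hk.1 i
    rintro (h | ⟨h, h'⟩)
    · omega
    · exact this h' h
  · intro a _ b _ hab
    exact stdFin_injective w hab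
  · intro s hs
    obtain ⟨k, rfl⟩ := (Finite.injective_iff_surjective.1 (stdFin_injective w)) s
    simp only [Finset.mem_filter, Finset.mem_univ, true_and] at hs
    rw [sort_symm_eq (fillBlocks_outcome w).1 (fillBlocks_outcome w).2, ← not_lt,
      stdFin_lt_iff, isBlockStart_fillBlocks] at hs
    exact ⟨k, by simp only [Finset.mem_filter, Finset.mem_univ, true_and]; exact ⟨hs.1, by omega⟩,
      rfl⟩

theorem blockIndex_fillBlocks_lt_iff {n : ℕ} (w : Fin n → ℕ) (i j : Fin n) :
    blockIndex (fillBlocks w) i < blockIndex (fillBlocks w) j ↔ w i < w j := by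
  rw [blockIndex_fillBlocks, blockIndex_fillBlocks]
  constructor
  · intro h
    by_contra hc
    refine absurd h (not_lt.2 (Finset.card_le_card fun k hk => ?_))
    simp only [Finset.mem_filter, Finset.mem_univ, true_and] at hk ⊢
    exact ⟨hk.1, by omega⟩
  · intro h
    apply Finset.card_lt_card
    rw [Finset.ssubset_iff_of_subset]
    · have hne : (Finset.univ.filter fun k => w k = w j).Nonempty := ⟨j, by simp⟩
      have hm := Finset.min'_mem _ hne
      set m := (Finset.univ.filter fun k => w k = w j).min' hne with hmdef
      simp only [Finset.mem_filter, Finset.mem_univ, true_and] at hm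
      refine ⟨m, ?_, ?_⟩
      · simp only [Finset.mem_filter, Finset.mem_univ, true_and]
        refine ⟨fun l hl hwl => ?_, hm.le⟩
        exact absurd hl (not_lt.2 (Finset.min'_le _ l (by simp [hwl, hm])))
      · simp only [Finset.mem_filter, Finset.mem_univ, true_and]
        omega
    · intro k hk
      simp only [Finset.mem_filter, Finset.mem_univ, true_and] at hk ⊢
      exact ⟨hk.1, by omega⟩

/-- `fillBlocks w` depends only on the relative order of the letters of `w`. -/
theorem fillBlocks_congr {n : ℕ} {v w : Fin n → ℕ} (h : ∀ i j, v i < v j ↔ w i < w j) :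
    fillBlocks v = fillBlocks w := by
  have he : ∀ i j, v i = v j ↔ w i = w j := fun i j => by
    have := h i j
    have := h j i
    omega
  have hs : ∀ i, standardize v i = standardize w i := fun i => by
    simp only [standardize, h, he]
  funext i
  simp only [fillBlocks, hs, he]

/-- A permutation `σ` moves the blocks of `α` as it moves the letters of a word: the block number
at position `i` of `σ • α` is the one at position `σ⁻¹ i` of `α`, and the entries of each block
again appear in increasing order. -/
instance (n : ℕ) : MulAction (Equiv.Perm (Fin n)) (UPF n) where
  smul σ α := ⟨fillBlocks (blockIndex α.1 ∘ ⇑σ⁻¹), isUPF_fillBlocks _⟩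
  one_smul α := Subtype.ext (fillBlocks_blockIndex α.2)
  mul_smul σ τ α := Subtype.ext (fillBlocks_congr fun i j => by
    simp only [Function.comp]
    exact (blockIndex_fillBlocks_lt_iff (blockIndex α.1 ∘ ⇑τ⁻¹) (σ⁻¹ i) (σ⁻¹ j)).symm)

theorem smul_val {n : ℕ} (σ : Equiv.Perm (Fin n)) (α : UPF n) :
    (σ • α).1 = fillBlocks (blockIndex α.1 ∘ ⇑σ⁻¹) := rfl

/-- The adjacent transposition `(i, i + 1)` fixes `α` if the entries `i` and `i + 1` of `α` are in
the same block, and exchanges these two entries otherwise. -/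
theorem swap_smul_val {n : ℕ} (α : UPF n) (i i' : Fin n) (hi : (i' : ℕ) = i + 1) :
    (Equiv.swap i i' • α).1 =
      if blockIndex α.1 i = blockIndex α.1 i' then α.1 else α.1 ∘ ⇑(Equiv.swap i i') := by
  rw [smul_val, Equiv.swap_inv]
  set b := blockIndex α.1 with hb
  split_ifs with h
  · have : b ∘ ⇑(Equiv.swap i i') = b := by
      funext k
      rcases eq_or_ne k i with rfl | h1
      · simp [h]
      rcases eq_or_ne k i' with rfl | h2
      · simp [h]
      simp [Equiv.swap_apply_of_ne_of_ne h1 h2]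
    rw [this, hb, fillBlocks_blockIndex α.2]
  · conv_rhs => rw [← fillBlocks_blockIndex α.2, ← hb]
    have hord : ∀ j k, b (Equiv.swap i i' j) = b (Equiv.swap i i' k) →
        (Equiv.swap i i' j < Equiv.swap i i' k ↔ j < k) := by
      intro j k hjk
      simp only [Equiv.swap_apply_def, Fin.lt_def] at hjk ⊢
      have e1 : ∀ x y : Fin n, x = y ↔ (x : ℕ) = y := fun x y => Fin.ext_iff
      split_ifs at hjk ⊢ <;> simp_all <;> omega
    have hstd : ∀ k, standardize (b ∘ ⇑(Equiv.swap i i')) k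
        = standardize b (Equiv.swap i i' k) := by
      intro k
      apply Finset.card_bij (fun j _ => Equiv.swap i i' j)
      · intro j hj
        simp only [Finset.mem_filter, Finset.mem_univ, true_and, Function.comp] at hj ⊢
        exact hj.imp_right fun hj => ⟨hj.1, (hord j k hj.1).2 hj.2⟩
      · intro x _ y _ hxy
        exact (Equiv.swap i i').injective hxy
      · intro j hj
        obtain ⟨l, rfl⟩ := (Equiv.swap i i').surjective j
        simp only [Finset.mem_filter, Finset.mem_univ, true_and, Function.comp] at hj ⊢
        exact ⟨l, hj.imp_right fun hj => ⟨hj.1, (hord l k hj.1).1 hj.2⟩, rfl⟩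
    have hex : ∀ k, (∃ j < k, (b ∘ ⇑(Equiv.swap i i')) j = (b ∘ ⇑(Equiv.swap i i')) k)
        ↔ ∃ j < Equiv.swap i i' k, b j = b (Equiv.swap i i' k) := by
      intro k
      constructor
      · rintro ⟨j, hj, hjk⟩
        exact ⟨Equiv.swap i i' j, (hord j k hjk).2 hj, hjk⟩
      · rintro ⟨j, hj, hjk⟩
        obtain ⟨l, rfl⟩ := (Equiv.swap i i').surjective j
        exact ⟨l, (hord l k hjk).1 hj, hjk⟩
    funext k
    apply Fin.ext
    have hk := hex k
    simp only [fillBlocks, Function.comp_apply] at hk ⊢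
    rw [hstd]
    exact if_congr hk rfl rfl

theorem sum_fillBlocks {n : ℕ} (w : Fin n → ℕ) :
    ∑ i, ((fillBlocks w i : ℕ) + 1) =
      ∑ i : Fin n, (i : ℕ) + (Finset.univ.image w).card := by
  have h1 : ∀ i, (fillBlocks w i : ℕ) + 1 =
      standardize w i + if ∀ j < i, w j ≠ w i then 1 else 0 := by
    intro i
    simp only [fillBlocks]
    by_cases h : ∃ j < i, w j = w i
    · rw [if_pos h, if_neg (by push Not; exact h)]
      obtain ⟨j, hj, hw⟩ := h
      have := (standardize_lt_iff w j i).2 (Or.inr ⟨hw, hj⟩)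
      omega
    · rw [if_neg h, if_pos (by push Not at h; exact h)]
  rw [Finset.sum_congr rfl fun i _ => h1 i, Finset.sum_add_distrib]
  congr 1
  · exact Function.Bijective.sum_comp (Finite.injective_iff_bijective.1 (stdFin_injective w))
      (fun i : Fin n => (i : ℕ))
  · rw [← Finset.card_filter]
    apply Finset.card_bij (fun k _ => w k)
    · intro k _
      simp
    · intro x hx y hy hxy
      simp only [Finset.mem_filter, Finset.mem_univ, true_and] at hx hy
      rcases lt_trichotomy x y with hlt | heq | hlt
      · exact absurd hxy (hy x hlt)
      · exact heq
      · exact absurd hxy.symm (hx y hlt)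
    · intro v hv
      obtain ⟨j, -, rfl⟩ := Finset.mem_image.1 hv
      have hne : (Finset.univ.filter fun k => w k = w j).Nonempty := ⟨j, by simp⟩
      have hm := Finset.min'_mem _ hne
      simp only [Finset.mem_filter, Finset.mem_univ, true_and] at hm
      refine ⟨_, ?_, hm⟩
      simp only [Finset.mem_filter, Finset.mem_univ, true_and]
      intro l hl hwl
      exact absurd hl (not_lt.2 (Finset.min'_le _ l (by simp [hwl, hm])))

theorem area_smul {n : ℕ} (σ : Equiv.Perm (Fin n)) (α : UPF n) :
    area (σ • α).1 = area α.1 := by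
  have h : (Finset.univ.image (blockIndex α.1 ∘ ⇑σ⁻¹)) = Finset.univ.image (blockIndex α.1) := by
    rw [← Finset.image_image, Finset.image_univ_equiv]
  conv_rhs => rw [← fillBlocks_blockIndex α.2]
  rw [smul_val, area, area, sum_fillBlocks, sum_fillBlocks, h]

/-- The unit interval parking functions of length `n` and area `k`. -/
def UPFArea (n k : ℕ) : Type := {α : UPF n // area α.1 = k}

noncomputable instance (n k : ℕ) : Fintype (UPFArea n k) :=
  @Fintype.ofFinite _ (inferInstanceAs (Finite {_α : UPF n // _}))

instance (n k : ℕ) : MulAction (Equiv.Perm (Fin n)) (UPFArea n k) where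
  smul σ α := ⟨σ • α.1, (area_smul σ α.1).trans α.2⟩
  one_smul α := Subtype.ext (one_smul _ α.1)
  mul_smul σ τ α := Subtype.ext (mul_smul σ τ α.1)

/-! ### Symmetric functions

Symmetric functions are taken inside the ring of formal power series with complex coefficients in
countably many variables. -/

/-- Formal power series over `ℂ` in countably many variables. -/
abbrev Series : Type := MvPowerSeries ℕ ℂ

/-- The complete homogeneous symmetric function `h_k`, the sum of all monomials of degree `k`. -/
noncomputable def hSymm (k : ℕ) : Series :=
  fun m => if m.degree = k then 1 else 0

/-- `h_c = h_{c_1} h_{c_2} ⋯`. -/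
noncomputable def hList (c : List ℕ) : Series := (c.map hSymm).prod

open Classical in
/-- The power sum symmetric function `p_k = ∑ x_i ^ k` for `k ≥ 1`, and `p_0 = 1`. -/
noncomputable def pSymm (k : ℕ) : Series :=
  fun m => if ∃ i, m = Finsupp.single i k then 1 else 0

/-- `p_{cyc(σ)}`, the product of the `p_k` over the cycle lengths `k` of `σ`, with fixed points. -/
noncomputable def pCycle {n : ℕ} (σ : Equiv.Perm (Fin n)) : Series :=
  (σ.partition.parts.map pSymm).prod

/-- The Frobenius characteristic `(1 / n!) ∑_σ χ(σ) p_{cyc(σ)}` of a representation with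
character `χ` of the symmetric group. -/
noncomputable def frobeniusChar {n : ℕ} {V : Type*} [AddCommGroup V] [Module ℂ V]
    (ρ : Representation ℂ (Equiv.Perm (Fin n)) V) : Series :=
  (n.factorial : ℂ)⁻¹ • ∑ σ : Equiv.Perm (Fin n), ρ.character σ • pCycle σ

/-- The graded Frobenius characteristic `UPF_n(x, t)`: the coefficient of `t ^ k` is the Frobenius
characteristic of the permutation representation on the functions of area `k`. No area exceeds
`binom(n+1, 2)`. -/
noncomputable def gradedFrobenius (n : ℕ) : Series[X] :=
  ∑ k ∈ Finset.range ((n + 1).choose 2 + 1),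
    Polynomial.C (frobeniusChar
      (Representation.ofMulAction ℂ (Equiv.Perm (Fin n)) (UPFArea n k))) * Polynomial.X ^ k

/-! ### Generating functions

Power series in `z` over the Laurent polynomials in `t`. -/

/-- `H(z) = ∑ h_n z ^ n`. -/
noncomputable def HSeries : PowerSeries Series[T;T⁻¹] :=
  PowerSeries.mk fun n => LaurentPolynomial.C (hSymm n)

/-- `t`, as a constant power series in `z`. -/
noncomputable def tVar : PowerSeries Series[T;T⁻¹] :=
  PowerSeries.C (LaurentPolynomial.T 1)

/-- `[m]_t = 1 + t + ⋯ + t ^ (m - 1)`. -/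
noncomputable def tNumber (m : ℕ) : PowerSeries Series[T;T⁻¹] :=
  ∑ i ∈ Finset.range m, tVar ^ i

/-- `H(tz)`. -/
noncomputable def HSeriesTz : PowerSeries Series[T;T⁻¹] :=
  PowerSeries.rescale (LaurentPolynomial.T 1) HSeries

/-- `∑ UPF_n(x, t) z ^ n`. -/
noncomputable def gradedFrobeniusSeries : PowerSeries Series[T;T⁻¹] :=
  PowerSeries.mk fun n => Polynomial.toLaurent (gradedFrobenius n)

end UnitParking

namespace UnitParking

/-! A unit interval parking function is the same thing as its word of block numbers, and the words
that occur are those whose set of letters is `{1, …, l}` for some `l`, the number of blocks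
(`blockIndex_fillBlocks_of_image`, `image_blockIndex`). Under this encoding `S_n` just permutes the
positions of the word, and the area is `n - l`.

Frobenius characteristics are compared coefficient by coefficient. For a permutation representation
on `X`, the coefficient of a monomial `x^m` is the average over `σ` of the fixed points in `X` times
the fixed colourings of `Fin n` with monomial `x^m`. By Burnside this is the number of orbits of
`S_n` on pairs of a point and a colouring (`coeff_frobeniusChar_ofMulAction`).

For parking functions with `l` blocks, the orbit of a pair remembers exactly which colours, with
multiplicity, each block receives. Orbits are therefore ordered factorizations of `x^m` into `l`
nontrivial monomials (`card_orbits`). For `m` of degree `n`, their number is also the coefficient of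
`x^m` in `(h_1 + h_2 + ⋯)^l`, that is, in the sum of `h_c` over compositions `c` of `n` with `l`
parts (`coeff_sum_hList`).

The sum over weakly increasing functions follows because taking contents is a bijection from them to
compositions (`sum_monotone_eq_sum_composition`). Splitting off the first part of a composition
gives a recursion, which is the generating function identity after multiplication by the
denominator. -/

/-! ### Frobenius characteristics of permutation representations. -/

theorem character_ofMulAction {G X : Type*} [Group G] [MulAction G X] [Finite X] (g : G) :
    (Representation.ofMulAction ℂ G X).character g = (Nat.card (MulAction.fixedBy X g) : ℂ) := by
  classical
  have := Fintype.ofFinite X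
  let b := MonoidAlgebra.basis X ℂ
  have hb : ∀ x, b x = MonoidAlgebra.single x 1 := fun x => rfl
  have hr : ∀ v x, b.repr v x = v.coeff x := fun v x => rfl
  rw [Representation.character, LinearMap.trace_eq_matrix_trace ℂ b, Matrix.trace]
  simp only [Matrix.diag_apply, LinearMap.toMatrix_apply, hb, hr,
    Representation.ofMulAction_single, MonoidAlgebra.coeff_single, Finsupp.single_apply]
  rw [Finset.sum_boole, Nat.card_eq_fintype_card, Fintype.card_subtype]
  rfl

section Cycles

variable {α : Type*} [Fintype α] [DecidableEq α] (σ : Equiv.Perm α)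

open Classical in
/-- The product over the cycles of `σ`, fixed points included, in terms of the cycle type. -/
theorem prod_parts_partition {M : Type*} [CommMonoid M] (F : ℕ → M) :
    (σ.partition.parts.map F).prod =
      ∏ q : Quotient (Equiv.Perm.SameCycle.setoid σ),
        F (Finset.univ.filter fun i => Quotient.mk _ i = q).card := by
  have hmem : ∀ (q : Quotient (Equiv.Perm.SameCycle.setoid σ)) i,
      Quotient.mk _ i = q ↔ σ.SameCycle q.out i := by
    intro q i
    conv_lhs => rw [← q.out_eq]
    rw [Quotient.eq]
    exact ⟨Equiv.Perm.SameCycle.symm, Equiv.Perm.SameCycle.symm⟩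
  -- The cycle type omits fixed points and the partition adds them as parts equal to 1, so the
  -- classes are split by whether their representative is moved.
  rw [Equiv.Perm.parts_partition, Multiset.map_add, Multiset.prod_add, Multiset.map_replicate,
    Multiset.prod_replicate, Equiv.Perm.cycleType_def, Multiset.map_map,
    ← Finset.prod_filter_mul_prod_filter_not Finset.univ
      (fun q : Quotient (Equiv.Perm.SameCycle.setoid σ) => q.out ∈ σ.support)]
  congr 1
  · symm
    refine Finset.prod_bij (fun q _ => σ.cycleOf q.out) ?_ ?_ ?_ ?_
    · intro q hq
      simpa [Equiv.Perm.cycleOf_mem_cycleFactorsFinset_iff] using hq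
    · intro q hq r hr h
      rw [← q.out_eq, hmem]
      have hq' : q.out ∈ (σ.cycleOf r.out).support := by
        rw [← h, Equiv.Perm.mem_support_cycleOf_iff]
        exact ⟨.refl _ _, (Finset.mem_filter.1 hq).2⟩
      exact ((Equiv.Perm.mem_support_cycleOf_iff).1 hq').1
    · intro c hc
      obtain ⟨x, hx⟩ := (Equiv.Perm.mem_cycleFactorsFinset_iff.1 hc).1.nonempty_support
      have hs := (hmem (Quotient.mk _ x) x).1 rfl
      have hxs : x ∈ σ.support := Equiv.Perm.mem_cycleFactorsFinset_support_le hc hx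
      refine ⟨Quotient.mk _ x, ?_, ?_⟩
      · simp only [Finset.mem_filter, Finset.mem_univ, true_and, Equiv.Perm.mem_support] at hxs ⊢
        exact fun h => hxs ((hs.apply_eq_self_iff).1 h)
      · rw [hs.cycleOf_eq, Equiv.Perm.cycle_is_cycleOf hx hc]
    · intro q hq
      simp only [Function.comp]
      congr 2
      ext i
      simp only [Finset.mem_filter, Finset.mem_univ, true_and] at hq
      simp only [Finset.mem_filter, Finset.mem_univ, true_and, hmem,
        Equiv.Perm.mem_support_cycleOf_iff, hq, and_true]
  · symm
    have hfix : ∀ q : Quotient (Equiv.Perm.SameCycle.setoid σ), q.out ∉ σ.support →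
        ∀ i, σ.SameCycle q.out i ↔ i = q.out := by
      intro q hq i
      rw [Equiv.Perm.notMem_support] at hq
      constructor
      · rintro ⟨k, rfl⟩
        exact (Function.IsFixedPt.perm_zpow hq k)
      · rintro rfl
        exact .refl _ _
    rw [Finset.prod_congr rfl (g := fun _ => F 1), Finset.prod_const]
    · congr 1
      rw [← Finset.card_compl]
      refine Finset.card_bij (fun q _ => q.out) ?_ ?_ ?_
      · intro q hq
        simpa using hq
      · intro q _ r _ h
        exact Quotient.out_inj.1 h
      · intro x hx
        have hs := (hmem (Quotient.mk _ x) x).1 rfl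
        have hx' : (Quotient.mk (Equiv.Perm.SameCycle.setoid σ) x).out ∉ σ.support := by
          simp only [Finset.mem_compl, Equiv.Perm.mem_support, not_not] at hx ⊢
          exact (hs.apply_eq_self_iff).2 hx
        exact ⟨Quotient.mk _ x, by simpa using hx', ((hfix _ hx' x).1 hs).symm⟩
    · intro q hq
      simp only [Finset.mem_filter, Finset.mem_univ, true_and] at hq
      refine congrArg F (Finset.card_eq_one.2 ⟨q.out, Finset.ext fun i => ?_⟩)
      rw [Finset.mem_filter, Finset.mem_singleton, hmem, hfix q hq]
      exact and_iff_right (Finset.mem_univ i)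

end Cycles

/-- The monomial `∏ x_{f i}` of a colouring `f`. -/
noncomputable def weight {n : ℕ} (f : Fin n → ℕ) : ℕ →₀ ℕ := ∑ i, Finsupp.single (f i) 1

theorem weight_comp {n : ℕ} (f : Fin n → ℕ) (σ : Equiv.Perm (Fin n)) :
    weight (f ∘ ⇑σ) = weight f :=
  Equiv.sum_comp σ fun i => Finsupp.single (f i) 1

theorem degree_weight {n : ℕ} (f : Fin n → ℕ) : (weight f).degree = n := by
  simp [weight, map_sum]

/-- The colourings of `Fin n` with a given monomial. -/
def Colouring (n : ℕ) (m : ℕ →₀ ℕ) : Type := {f : Fin n → ℕ // weight f = m}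

instance (n : ℕ) (m : ℕ →₀ ℕ) : Finite (Colouring n m) := by
  refine Set.Finite.subset (Fintype.piFinset fun _ : Fin n => m.support).finite_toSet ?_
  rintro f rfl
  simp only [Finset.mem_coe, Fintype.mem_piFinset, Finsupp.mem_support_iff]
  intro i h
  simp only [weight, Finsupp.finsetSum_apply, Finset.sum_eq_zero_iff] at h
  simpa using h i (Finset.mem_univ i)

instance (n : ℕ) (m : ℕ →₀ ℕ) : MulAction (Equiv.Perm (Fin n)) (Colouring n m) where
  smul σ f := ⟨f.1 ∘ ⇑σ⁻¹, (weight_comp _ _).trans f.2⟩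
  one_smul _ := rfl
  mul_smul _ _ _ := rfl

theorem Colouring.smul_val {n : ℕ} {m : ℕ →₀ ℕ} (σ : Equiv.Perm (Fin n)) (f : Colouring n m) :
    (σ • f).1 = f.1 ∘ ⇑σ⁻¹ := rfl

open Classical in
theorem coeff_pSymm (k : ℕ) (m : ℕ →₀ ℕ) :
    MvPowerSeries.coeff m (pSymm k) = if ∃ i, m = Finsupp.single i k then 1 else 0 := by
  unfold pSymm
  rfl

/-- Expanding the product of power sums means choosing one variable for each cycle of `σ`, which is
a colouring constant on cycles; these are the colourings that `σ` fixes. -/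
theorem coeff_pCycle {n : ℕ} (σ : Equiv.Perm (Fin n)) (m : ℕ →₀ ℕ) :
    MvPowerSeries.coeff m (pCycle σ) =
      (Nat.card (MulAction.fixedBy (Colouring n m) σ) : ℂ) := by
  classical
  let Q := Quotient (Equiv.Perm.SameCycle.setoid σ)
  let N : Q → ℕ := fun q => (Finset.univ.filter fun i => Quotient.mk _ i = q).card
  have hN : ∀ q, N q ≠ 0 := fun q => by
    rw [Finset.card_ne_zero]
    exact ⟨q.out, by simp⟩
  have hw : ∀ g : Q → ℕ, weight (fun i => g (Quotient.mk _ i)) =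
      ∑ q, Finsupp.single (g q) (N q) := by
    intro g
    rw [weight, ← Finset.sum_fiberwise Finset.univ (fun i => (Quotient.mk _ i : Q))]
    refine Finset.sum_congr rfl fun q _ => ?_
    rw [Finset.sum_congr rfl (g := fun _ => Finsupp.single (g q) 1), Finset.sum_const]
    · simp [N]
    · intro i hi
      rw [(Finset.mem_filter.1 hi).2]
  have hinv : ∀ f : Fin n → ℕ, f ∘ ⇑σ⁻¹ = f →
      ∀ i, f (Quotient.mk (Equiv.Perm.SameCycle.setoid σ) i).out = f i := by
    intro f hf i
    have h1 : ∀ j, f (σ j) = f j := fun j => by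
      conv_lhs => rw [← hf]
      simp
    have h2 : ∀ (j k), σ.SameCycle j k → f j = f k := by
      rintro j k ⟨z, rfl⟩
      induction z with
      | zero => simp
      | succ z ih => rw [add_comm, zpow_add, zpow_one, Equiv.Perm.mul_apply, h1, ih]
      | pred z ih =>
        rw [ih, sub_eq_add_neg, add_comm, zpow_add, zpow_neg_one, Equiv.Perm.mul_apply,
          ← h1 (σ⁻¹ _), ← Equiv.Perm.mul_apply, mul_inv_cancel, Equiv.Perm.one_apply]
    exact h2 _ _ (Quotient.mk_out (s := Equiv.Perm.SameCycle.setoid σ) i)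
  have hcoe : ∀ l : Q →₀ (ℕ →₀ ℕ), ∏ q, MvPowerSeries.coeff (l q) (pSymm (N q)) =
      if ∀ q, ∃ i, l q = Finsupp.single i (N q) then (1 : ℂ) else 0 := by
    intro l
    simp only [coeff_pSymm]
    rw [Finset.prod_boole]
    simp
  rw [pCycle, prod_parts_partition σ pSymm, MvPowerSeries.coeff_prod]
  rw [Finset.sum_congr rfl fun l _ => hcoe l, Finset.sum_boole, ← Nat.card_eq_finsetCard]
  congr 1
  symm
  -- A fixed colouring selects from the factor of each cycle `q` the pure power of its colour there.
  -- Since `N q ≠ 0`, that power determines the colour, which gives injectivity.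
  refine Nat.card_eq_of_bijective (fun f => ⟨Finsupp.equivFunOnFinite.symm
    fun q : Q => Finsupp.single (f.1.1 q.out) (N q), ?_⟩) ⟨?_, ?_⟩
  · have hf : f.1.1 ∘ ⇑σ⁻¹ = f.1.1 := congrArg Subtype.val f.2
    rw [Finset.mem_filter, Finset.mem_finsuppAntidiag]
    refine ⟨⟨?_, Finset.subset_univ _⟩, fun q => ⟨_, rfl⟩⟩
    have := hw fun q => f.1.1 q.out
    simp only [hinv _ hf] at this
    exact this.symm.trans f.1.2
  · rintro ⟨f, hf⟩ ⟨g, hg⟩ h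
    have hf : f.1 ∘ ⇑σ⁻¹ = f.1 := congrArg Subtype.val hf
    have hg : g.1 ∘ ⇑σ⁻¹ = g.1 := congrArg Subtype.val hg
    refine Subtype.ext (Subtype.ext (funext fun i => ?_))
    have h1 := DFunLike.congr_fun (congrArg Subtype.val h) (Quotient.mk _ i)
    simp only [Finsupp.equivFunOnFinite_symm_apply_apply] at h1
    have h2 := (Finsupp.single_left_inj (hN _)).1 h1
    rwa [hinv _ hf, hinv _ hg] at h2
  · rintro ⟨l, hl⟩
    rw [Finset.mem_filter, Finset.mem_finsuppAntidiag] at hl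
    choose g hg using hl.2
    refine ⟨⟨⟨fun i => g (Quotient.mk _ i), ?_⟩, ?_⟩, ?_⟩
    · rw [hw, ← hl.1.1]
      exact Finset.sum_congr rfl fun q _ => (hg q).symm
    · refine Subtype.ext (funext fun i => ?_)
      change g (Quotient.mk _ (σ⁻¹ i)) = g (Quotient.mk _ i)
      congr 1
      rw [Quotient.eq]
      exact ⟨1, by simp⟩
    · refine Subtype.ext (Finsupp.ext fun q => ?_)
      simp only [Finsupp.equivFunOnFinite_symm_apply_apply]
      rw [hg]
      congr 2
      exact q.out_eq

/-- Burnside's lemma on the product: a pair is fixed by `σ` exactly when both components are, so its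
fixed points number the character value times the coefficient of `pCycle σ`. -/
theorem coeff_frobeniusChar_ofMulAction {n : ℕ} {X : Type*} [MulAction (Equiv.Perm (Fin n)) X]
    [Finite X] (m : ℕ →₀ ℕ) :
    MvPowerSeries.coeff m
        (frobeniusChar (Representation.ofMulAction ℂ (Equiv.Perm (Fin n)) X)) =
      (Nat.card (MulAction.orbitRel.Quotient (Equiv.Perm (Fin n)) (X × Colouring n m)) : ℂ) := by
  classical
  have := Fintype.ofFinite (X × Colouring n m)
  have h := MulAction.sum_card_fixedBy_eq_card_orbits_mul_card_group
    (Equiv.Perm (Fin n)) (X × Colouring n m)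
  rw [Fintype.card_perm, Fintype.card_fin] at h
  rw [frobeniusChar, map_smul, map_sum, smul_eq_mul, inv_mul_eq_iff_eq_mul₀ (by exact_mod_cast n.factorial_ne_zero),
    mul_comm, Nat.card_eq_fintype_card, ← Nat.cast_mul, ← h, Nat.cast_sum]
  refine Finset.sum_congr rfl fun σ _ => ?_
  have hfix : MulAction.fixedBy (X × Colouring n m) σ =
      MulAction.fixedBy X σ ×ˢ MulAction.fixedBy (Colouring n m) σ :=
    Set.ext fun _ => Prod.ext_iff
  rw [map_smul, character_ofMulAction, coeff_pCycle, smul_eq_mul, ← Nat.cast_mul,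
    ← Nat.card_prod, ← Nat.card_eq_fintype_card, hfix]
  exact congrArg _ (Nat.card_congr (Equiv.Set.prod _ _)).symm

/-! ### Parking functions encoded by their words of block numbers. -/

theorem card_first_occurrences {n : ℕ} (w : Fin n → ℕ) (P : ℕ → Prop) [DecidablePred P] :
    (Finset.univ.filter fun k => (∀ j < k, w j ≠ w k) ∧ P (w k)).card =
      ((Finset.univ.image w).filter P).card := by
  apply Finset.card_bij (fun k _ => w k)
  · intro k hk
    simp only [Finset.mem_filter, Finset.mem_univ, true_and] at hk
    simpa using hk.2
  · intro x hx y hy hxy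
    simp only [Finset.mem_filter, Finset.mem_univ, true_and] at hx hy
    rcases lt_trichotomy x y with hlt | heq | hlt
    · exact absurd hxy (hy.1 x hlt)
    · exact heq
    · exact absurd hxy.symm (hx.1 y hlt)
  · intro v hv
    obtain ⟨hv, hP⟩ := Finset.mem_filter.1 hv
    obtain ⟨j, -, rfl⟩ := Finset.mem_image.1 hv
    have hne : (Finset.univ.filter fun k => w k = w j).Nonempty := ⟨j, by simp⟩
    have hm := Finset.min'_mem _ hne
    simp only [Finset.mem_filter, Finset.mem_univ, true_and] at hm
    refine ⟨_, ?_, hm⟩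
    simp only [Finset.mem_filter, Finset.mem_univ, true_and]
    refine ⟨fun l hl hwl => ?_, by rwa [hm]⟩
    exact absurd hl (not_lt.2 (Finset.min'_le _ l (by simp [hwl, hm])))

theorem blockIndex_fillBlocks_eq {n : ℕ} (w : Fin n → ℕ) (i : Fin n) :
    blockIndex (fillBlocks w) i = ((Finset.univ.image w).filter (· ≤ w i)).card := by
  rw [blockIndex_fillBlocks, card_first_occurrences w (· ≤ w i)]

theorem numBlocks_fillBlocks {n : ℕ} (w : Fin n → ℕ) :
    numBlocks (fillBlocks w) = (Finset.univ.image w).card := by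
  have h := card_first_occurrences w fun _ => True
  rw [Finset.filter_true] at h
  rw [← h, numBlocks]
  symm
  refine Finset.card_bij (fun k _ => stdFin w k) (fun k hk => ?_)
    (fun _ _ _ _ h => stdFin_injective w h) fun s hs => ?_
  · simp only [Finset.mem_filter, Finset.mem_univ, true_and, and_true] at hk ⊢
    exact (isBlockStart_fillBlocks w k).2 hk
  · obtain ⟨k, rfl⟩ := (Finite.injective_iff_surjective.1 (stdFin_injective w)) s
    simp only [Finset.mem_filter, Finset.mem_univ, true_and, and_true,
      isBlockStart_fillBlocks] at hs ⊢
    exact ⟨k, hs, rfl⟩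

/-- Passing to block numbers replaces each letter by its rank among the letters used, which changes
nothing if these are `1, …, l`. With `fillBlocks_blockIndex` and `image_blockIndex`, this makes
parking functions and such words equivalent. -/
theorem blockIndex_fillBlocks_of_image {n l : ℕ} {w : Fin n → ℕ}
    (hw : Finset.univ.image w = Finset.Icc 1 l) : blockIndex (fillBlocks w) = w := by
  funext i
  have hi : w i ∈ Finset.Icc 1 l := hw ▸ Finset.mem_image_of_mem w (Finset.mem_univ i)
  rw [Finset.mem_Icc] at hi
  rw [blockIndex_fillBlocks_eq, hw, show (Finset.Icc 1 l).filter (· ≤ w i) = Finset.Icc 1 (w i) by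
    ext j
    simp only [Finset.mem_filter, Finset.mem_Icc]
    omega]
  simp

theorem image_blockIndex {n : ℕ} {α : Fin n → Fin n} (h : IsUnitIntervalParkingFunction α) :
    Finset.univ.image (blockIndex α) = Finset.Icc 1 (numBlocks α) := by
  refine Finset.eq_of_subset_of_card_le (fun v hv => ?_) ?_
  · obtain ⟨i, -, rfl⟩ := Finset.mem_image.1 hv
    rw [Finset.mem_Icc]
    constructor
    · rw [← fillBlocks_blockIndex h, blockIndex_fillBlocks_eq, Nat.one_le_iff_ne_zero,
        Finset.card_ne_zero]
      exact ⟨_, Finset.mem_filter.2 ⟨Finset.mem_image_of_mem _ (Finset.mem_univ i), le_rfl⟩⟩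
    · exact Finset.card_le_card (Finset.monotone_filter_right _ fun _ _ hs => hs.1)
  · have := numBlocks_fillBlocks (blockIndex α)
    rw [fillBlocks_blockIndex h] at this
    simp [this]

theorem numBlocks_le {n : ℕ} (α : Fin n → Fin n) : numBlocks α ≤ n :=
  (Finset.card_filter_le _ _).trans (by simp)

/-- The preferences sum to `binom(n, 2)` plus the number of blocks, and `binom(n+1, 2) = binom(n, 2)
+ n`. -/
theorem area_eq {n : ℕ} {α : Fin n → Fin n} (h : IsUnitIntervalParkingFunction α) :
    area α = n - numBlocks α := by
  rw [← fillBlocks_blockIndex h, area, sum_fillBlocks, numBlocks_fillBlocks,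
    Fin.sum_univ_eq_sum_range (fun i => i), Finset.sum_range_id, ← Nat.choose_two_right,
    Nat.choose_succ_succ' n 1, Nat.choose_one_right, one_add_one_eq_two]
  omega

theorem blockIndex_smul {n : ℕ} (σ : Equiv.Perm (Fin n)) (α : UPF n) :
    blockIndex (σ • α).1 = blockIndex α.1 ∘ ⇑σ⁻¹ := by
  rw [smul_val]
  refine blockIndex_fillBlocks_of_image (l := numBlocks α.1) ?_
  rw [← Finset.image_image, Finset.image_univ_equiv, image_blockIndex α.2]

theorem blockIndex_injective {n : ℕ} {α β : UPF n} (h : blockIndex α.1 = blockIndex β.1) :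
    α = β := by
  apply Subtype.ext
  rw [← fillBlocks_blockIndex α.2, h, fillBlocks_blockIndex β.2]

/-! ### Orbits of coloured parking functions as factorizations of monomials. -/

/-- Two functions with fibres of equal sizes differ by a permutation. -/
theorem exists_perm_of_card_fiber_eq {ι A : Type*} [Fintype ι] [DecidableEq A] {f g : ι → A}
    (h : ∀ a, (Finset.univ.filter fun i => f i = a).card =
      (Finset.univ.filter fun i => g i = a).card) :
    ∃ σ : Equiv.Perm ι, f = g ∘ σ := by
  have e : ∀ a, Nonempty ({ i // f i = a } ≃ { i // g i = a }) := fun a => by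
    rw [← Fintype.card_eq, Fintype.card_subtype, Fintype.card_subtype, h]
  exact ⟨Equiv.ofFiberEquiv fun a => (e a).some, funext fun i => (Equiv.ofFiberEquiv_map _ i).symm⟩

/-- The `l`-tuples of nontrivial monomials with product `m`. -/
def Factorization (l : ℕ) (m : ℕ →₀ ℕ) : Type :=
  {g : Fin l → ℕ →₀ ℕ // (∀ j, g j ≠ 0) ∧ ∑ j, g j = m}

/-- The product over each block of the variables that a colouring attaches to it. -/
noncomputable def blockWeight {n : ℕ} (b f : Fin n → ℕ) (j : ℕ) : ℕ →₀ ℕ :=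
  ∑ i with b i = j + 1, Finsupp.single (f i) 1

theorem blockWeight_apply {n : ℕ} (b f : Fin n → ℕ) (j a : ℕ) :
    blockWeight b f j a = (Finset.univ.filter fun i => (b i, f i) = (j + 1, a)).card := by
  simp only [blockWeight, Finsupp.finsetSum_apply, Finsupp.single_apply, Finset.sum_boole,
    Finset.filter_filter, Prod.mk.injEq, Nat.cast_id]

theorem blockWeight_comp {n : ℕ} (b f : Fin n → ℕ) (σ : Equiv.Perm (Fin n)) (j : ℕ) :
    blockWeight (b ∘ σ) (f ∘ σ) j = blockWeight b f j := by
  simp only [blockWeight, Finset.sum_filter]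
  exact Equiv.sum_comp σ fun i => if b i = j + 1 then Finsupp.single (f i) 1 else 0

theorem sum_blockWeight {n l : ℕ} {b : Fin n → ℕ} (hb : Finset.univ.image b = Finset.Icc 1 l)
    (f : Fin n → ℕ) : ∑ j : Fin l, blockWeight b f j = weight f := by
  have hmem : ∀ i, b i ∈ Finset.Icc 1 l := fun i =>
    hb ▸ Finset.mem_image_of_mem b (Finset.mem_univ i)
  rw [Fin.sum_univ_eq_sum_range (blockWeight b f)]
  unfold weight blockWeight
  rw [← Finset.sum_fiberwise_of_maps_to (s := Finset.univ) (t := Finset.Icc 1 l)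
    fun i _ => hmem i]
  rw [Finset.range_eq_Ico, Finset.sum_Ico_add' (fun j => ∑ i with b i = j, Finsupp.single (f i) 1)]
  rfl

theorem blockWeight_ne_zero {n l : ℕ} {b : Fin n → ℕ}
    (hb : Finset.univ.image b = Finset.Icc 1 l) (f : Fin n → ℕ) (j : Fin l) :
    blockWeight b f j ≠ 0 := by
  have hj : (j : ℕ) + 1 ∈ Finset.univ.image b := by
    rw [hb, Finset.mem_Icc]
    omega
  obtain ⟨i, -, hi⟩ := Finset.mem_image.1 hj
  intro h
  have := DFunLike.congr_fun h (f i)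
  rw [blockWeight_apply, Finsupp.coe_zero, Pi.zero_apply, Finset.card_eq_zero,
    Finset.filter_eq_empty_iff] at this
  exact this (Finset.mem_univ i) (by rw [hi])

theorem exists_blockWeight_eq {n l : ℕ} {m : ℕ →₀ ℕ} (hm : m.degree = n)
    (g : Factorization l m) :
    ∃ b f : Fin n → ℕ, Finset.univ.image b = Finset.Icc 1 l ∧
      ∀ j : Fin l, blockWeight b f j = g.1 j := by
  -- One element for each occurrence of a variable in a factor, so the degree of `m` is the size of
  -- `T`. Any enumeration by `Fin n` gives suitable block numbers and colours.
  let T : Type := Σ j : Fin l, Σ a : (g.1 j).support, Fin (g.1 j a)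
  have hT : Fintype.card T = n := by
    simp only [T, Fintype.card_sigma, Fintype.card_fin]
    refine Eq.trans ?_ ((congrArg Finsupp.degree g.2.2).trans hm)
    rw [map_sum]
    exact Finset.sum_congr rfl fun j _ => Finset.sum_coe_sort (g.1 j).support (g.1 j)
  let e : Fin n ≃ T := (Fintype.equivFinOfCardEq hT).symm
  refine ⟨fun i => (e i).1 + 1, fun i => (e i).2.1, ?_, fun j => ?_⟩
  · ext v
    simp only [Finset.mem_image, Finset.mem_univ, true_and, Finset.mem_Icc]
    constructor
    · rintro ⟨i, rfl⟩
      have := (e i).1.2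
      omega
    · rintro ⟨h1, h2⟩
      obtain ⟨a, ha⟩ := Finsupp.support_nonempty_iff.2 (g.2.1 ⟨v - 1, by omega⟩)
      refine ⟨e.symm ⟨⟨v - 1, by omega⟩, ⟨a, ha⟩, ⟨0, ?_⟩⟩, ?_⟩
      · exact Nat.pos_of_ne_zero (Finsupp.mem_support_iff.1 ha)
      · rw [Equiv.apply_symm_apply]
        simp only
        omega
  · rw [blockWeight, Finset.sum_filter]
    rw [Equiv.sum_comp e fun t : T =>
      if (t.1 : ℕ) + 1 = (j : ℕ) + 1 then Finsupp.single (t.2.1 : ℕ) 1 else 0]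
    rw [Fintype.sum_sigma, Finset.sum_eq_single j]
    · simp only [if_true, Fintype.sum_sigma, Finset.sum_const, Finset.card_univ,
        Fintype.card_fin, Finsupp.smul_single, smul_eq_mul, mul_one]
      rw [Finset.sum_coe_sort (g.1 j).support fun a => Finsupp.single a (g.1 j a)]
      exact Finsupp.sum_single (g.1 j)
    · intro k _ hk
      refine Finset.sum_eq_zero fun t _ => if_neg fun h => hk (Fin.ext ?_)
      simpa using h
    · simp

/-- Area `k` means `l` blocks. Up to permuting positions, a parking function with a colouring is the
multiset of its pairs (block number, colour), and the monomials of the blocks record the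
multiplicities of these pairs. They are nontrivial because blocks are nonempty. -/
theorem card_orbits {n l k : ℕ} (hl : l + k = n) {m : ℕ →₀ ℕ} (hm : m.degree = n) :
    Nat.card (MulAction.orbitRel.Quotient (Equiv.Perm (Fin n)) (UPFArea n k × Colouring n m)) =
      Nat.card (Factorization l m) := by
  have him : ∀ α : UPFArea n k, Finset.univ.image (blockIndex α.1.1) = Finset.Icc 1 l := by
    intro α
    have h1 := area_eq α.1.2
    have h2 := numBlocks_le α.1.1
    have h3 := α.2
    rw [image_blockIndex α.1.2, show numBlocks α.1.1 = l by omega]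
  let F : UPFArea n k × Colouring n m → Factorization l m := fun y =>
    ⟨fun j => blockWeight (blockIndex y.1.1.1) y.2.1 j, blockWeight_ne_zero (him _) _,
      (sum_blockWeight (him _) _).trans y.2.2⟩
  have hF : ∀ (σ : Equiv.Perm (Fin n)) y, F (σ • y) = F y := by
    rintro σ ⟨α, f⟩
    refine Subtype.ext (funext fun j => ?_)
    change blockWeight (blockIndex (σ • α.1).1) (σ • f).1 j = _
    rw [blockIndex_smul, Colouring.smul_val, blockWeight_comp]
  refine Nat.card_eq_of_bijective (Quotient.lift F ?_) ⟨?_, ?_⟩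
  · rintro _ y ⟨σ, rfl⟩
    exact hF σ y
  · intro x y
    refine Quotient.inductionOn₂ x y ?_
    rintro ⟨α, f⟩ ⟨β, g⟩ h
    -- Block number and colour must be matched by a single permutation, so the fibres of the joint
    -- map are compared. Their sizes are exponents in the block monomials, or 0 when the block
    -- number is out of range.
    obtain ⟨σ, hσ⟩ := exists_perm_of_card_fiber_eq
      (f := fun i => (blockIndex α.1.1 i, f.1 i)) (g := fun i => (blockIndex β.1.1 i, g.1 i)) (by
        rintro ⟨v, a⟩
        by_cases hv : v ∈ Finset.Icc 1 l
        · rw [Finset.mem_Icc] at hv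
          have := DFunLike.congr_fun (congrFun (congrArg Subtype.val h) ⟨v - 1, by omega⟩) a
          change blockWeight _ _ (v - 1) a = blockWeight _ _ (v - 1) a at this
          rwa [blockWeight_apply, blockWeight_apply, Nat.sub_add_cancel hv.1] at this
        · have : ∀ (α : UPFArea n k) (f : Fin n → ℕ),
              (Finset.univ.filter fun i => (blockIndex α.1.1 i, f i) = (v, a)).card = 0 := by
            intro α f
            rw [Finset.card_eq_zero, Finset.filter_eq_empty_iff]
            rintro i - hi
            apply hv
            rw [← him α]
            exact Finset.mem_image.2 ⟨i, Finset.mem_univ i, (Prod.ext_iff.1 hi).1⟩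
          rw [this, this])
    -- Permutations act by precomposition with the inverse, so `σ⁻¹` carries the second pair to the
    -- first.
    refine Quotient.sound ⟨σ⁻¹, Prod.ext (Subtype.ext (blockIndex_injective ?_)) (Subtype.ext ?_)⟩
    · change blockIndex (σ⁻¹ • β.1).1 = _
      rw [blockIndex_smul, inv_inv]
      exact funext fun i => (Prod.ext_iff.1 (congrFun hσ i)).1.symm
    · exact funext fun i => (Prod.ext_iff.1 (congrFun hσ i)).2.symm
  · intro g
    obtain ⟨b, f, hb, hg⟩ := exists_blockWeight_eq hm g
    have hbi := blockIndex_fillBlocks_of_image hb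
    have hnum : numBlocks (fillBlocks b) = l := by simp [numBlocks_fillBlocks, hb]
    refine ⟨Quotient.mk _ ⟨⟨⟨fillBlocks b, isUPF_fillBlocks b⟩, ?_⟩, ⟨f, ?_⟩⟩,
      Subtype.ext (funext fun j => ?_)⟩
    · rw [area_eq (isUPF_fillBlocks b), hnum]
      omega
    · rw [← sum_blockWeight hb f, ← g.2.2]
      exact Finset.sum_congr rfl fun j _ => hg j
    · change blockWeight (blockIndex (fillBlocks b)) f j = _
      rw [hbi, hg]

/-! ### Products of complete homogeneous functions over compositions. -/

/-- Compositions of `n + 1`, sorted by the first part. -/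
theorem sum_composition_succ {M : Type*} [AddCommMonoid M] (n : ℕ) (F : List ℕ → M) :
    ∑ c : Composition (n + 1), F c.blocks =
      ∑ p ∈ Finset.HasAntidiagonal.antidiagonal n, ∑ c : Composition p.2, F ((p.1 + 1) :: c.blocks) := by
  rw [Finset.sum_sigma']
  symm
  refine Finset.sum_bij (fun x hx => ⟨(x.1.1 + 1) :: x.2.blocks, ?_, ?_⟩) ?_ ?_ ?_ ?_
  · intro i hi
    rcases List.mem_cons.1 hi with rfl | hi
    · omega
    · exact x.2.blocks_pos hi
  · have := Finset.HasAntidiagonal.mem_antidiagonal.1 (Finset.mem_sigma.1 hx).1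
    rw [List.sum_cons, x.2.blocks_sum]
    omega
  · exact fun _ _ => Finset.mem_univ _
  · rintro ⟨⟨a, b⟩, c⟩ hx ⟨⟨a', b'⟩, c'⟩ hy h
    have h := congrArg Composition.blocks h
    simp only [List.cons.injEq, Nat.add_right_cancel_iff] at h
    obtain ⟨rfl, h⟩ := h
    have h1 := Finset.HasAntidiagonal.mem_antidiagonal.1 (Finset.mem_sigma.1 hx).1
    have h2 := Finset.HasAntidiagonal.mem_antidiagonal.1 (Finset.mem_sigma.1 hy).1
    obtain rfl : b = b' := by
      simp only at h1 h2
      omega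
    rw [Composition.ext h]
  · rintro ⟨l, hpos, hsum⟩ -
    match l with
    | [] => simp at hsum
    | a :: l =>
      have ha : 0 < a := hpos List.mem_cons_self
      rw [List.sum_cons] at hsum
      refine ⟨⟨(a - 1, n + 1 - a), ⟨l, fun h => hpos (List.mem_cons_of_mem _ h), ?_⟩⟩, ?_, ?_⟩
      · simp only
        omega
      · simp only [Finset.mem_sigma, Finset.HasAntidiagonal.mem_antidiagonal, Finset.mem_univ, and_true]
        omega
      · simp only [Composition.mk.injEq, List.cons.injEq, and_true]
        omega
  · exact fun _ _ => rfl

theorem coeff_hSymm (k : ℕ) (m : ℕ →₀ ℕ) :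
    MvPowerSeries.coeff m (hSymm k) = if m.degree = k then 1 else 0 := rfl

/-- The sum of all monomials other than `1`. -/
noncomputable def nontrivialMonomials : Series := fun m => if m ≠ 0 then 1 else 0

theorem coeff_nontrivialMonomials (m : ℕ →₀ ℕ) :
    MvPowerSeries.coeff m nontrivialMonomials = if m ≠ 0 then 1 else 0 := rfl

theorem coeff_nontrivialMonomials_pow (l : ℕ) (m : ℕ →₀ ℕ) :
    MvPowerSeries.coeff m (nontrivialMonomials ^ l) = (Nat.card (Factorization l m) : ℂ) := by
  classical
  have h : nontrivialMonomials ^ l = ∏ _j : Fin l, nontrivialMonomials := by simp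
  have hc : ∀ g : Fin l →₀ (ℕ →₀ ℕ), ∏ j, MvPowerSeries.coeff (g j) nontrivialMonomials =
      if ∀ j, g j ≠ 0 then (1 : ℂ) else 0 := by
    intro g
    simp only [coeff_nontrivialMonomials]
    rw [Finset.prod_boole]
    simp
  rw [h, MvPowerSeries.coeff_prod, Finset.sum_congr rfl fun g _ => hc g, Finset.sum_boole, ← Nat.card_eq_finsetCard]
  congr 1
  refine Nat.card_congr (Equiv.subtypeEquiv Finsupp.equivFunOnFinite fun g => ?_)
  simp [Finset.mem_finsuppAntidiag, and_comm]

/-- The sum of all nontrivial monomials is `h_1 + h_2 + ⋯`, so the left side is the degree `n`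
component of its `l`-th power. The induction on `l` peels off the first part. -/
theorem coeff_sum_hList (l n : ℕ) (m : ℕ →₀ ℕ) :
    MvPowerSeries.coeff m
        (∑ c : Composition n, if c.blocks.length = l then hList c.blocks else 0) =
      if m.degree = n then MvPowerSeries.coeff m (nontrivialMonomials ^ l) else 0 := by
  classical
  induction l generalizing n m with
  | zero =>
    cases n with
    | zero =>
      have : ∀ c : Composition 0, c.blocks = [] := fun c =>
        List.length_eq_zero_iff.1 (Nat.le_zero.1 c.length_le)
      have hu : (Finset.univ : Finset (Composition 0)).card = 1 := by
        rw [Finset.card_univ, composition_card]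
        rfl
      simp only [this, List.length_nil, if_true, Finset.sum_const, hu, one_smul, pow_zero, hList,
        List.map_nil, List.prod_nil, MvPowerSeries.coeff_one, Finsupp.degree_eq_zero_iff]
      split_ifs <;> rfl
    | succ n =>
      rw [Finset.sum_eq_zero, map_zero]
      · rw [pow_zero, MvPowerSeries.coeff_one]
        split_ifs with h1 h2
        · simp [h2] at h1
        · rfl
        · rfl
      · intro c _
        refine if_neg fun h => ?_
        have := c.blocks_sum
        simp [List.length_eq_zero_iff.1 h] at this
  | succ l ih =>
    cases n with
    | zero =>
      rw [Finset.sum_eq_zero, map_zero]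
      · split_ifs with h
        · rw [Finsupp.degree_eq_zero_iff] at h
          subst h
          rw [MvPowerSeries.coeff_zero_eq_constantCoeff_apply, map_pow,
            ← MvPowerSeries.coeff_zero_eq_constantCoeff_apply, coeff_nontrivialMonomials]
          simp
        · rfl
      · intro c _
        have := c.length_le
        exact if_neg fun h => by simp only [Composition.length] at this; omega
    | succ n =>
      rw [sum_composition_succ n fun L => if L.length = l + 1 then hList L else 0]
      have hp : ∀ p : ℕ × ℕ, (∑ c : Composition p.2,
          if ((p.1 + 1) :: c.blocks).length = l + 1 then hList ((p.1 + 1) :: c.blocks) else 0) =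
          hSymm (p.1 + 1) *
            ∑ c : Composition p.2, if c.blocks.length = l then hList c.blocks else 0 := by
        intro p
        rw [Finset.mul_sum]
        refine Finset.sum_congr rfl fun c _ => ?_
        simp [hList]
      simp only [hp, map_sum, MvPowerSeries.coeff_mul, ih, pow_succ', coeff_hSymm,
        coeff_nontrivialMonomials]
      -- Once `m` is split as `a + b`, the degrees force the first part to be `a.degree` and the
      -- rest to sum to `b.degree`. At most one term survives, and none if `a = 0`.
      have hs : ∀ q ∈ Finset.HasAntidiagonal.antidiagonal m, (∑ p ∈ Finset.HasAntidiagonal.antidiagonal n,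
          (if q.1.degree = p.1 + 1 then (1 : ℂ) else 0) * if q.2.degree = p.2 then
            MvPowerSeries.coeff q.2 (nontrivialMonomials ^ l) else 0) =
          if m.degree = n + 1 then (if q.1 ≠ 0 then 1 else 0) *
            MvPowerSeries.coeff q.2 (nontrivialMonomials ^ l) else 0 := by
        rintro ⟨a, b⟩ hq
        have hd : a.degree + b.degree = m.degree := by
          rw [← map_add, Finset.HasAntidiagonal.mem_antidiagonal.1 hq]
        have ha : a = 0 ↔ a.degree = 0 := (Finsupp.degree_eq_zero_iff a).symm
        simp only [ne_eq, ha]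
        by_cases h : m.degree = n + 1 ∧ a.degree ≠ 0
        · rw [if_pos h.1, if_pos h.2, Finset.sum_eq_single (a.degree - 1, b.degree)]
          · rw [if_pos (by omega), if_pos rfl]
          · rintro ⟨i, j⟩ _ hne
            by_cases hi : a.degree = i + 1
            · rw [if_neg (c := b.degree = j), mul_zero]
              rintro rfl
              exact hne (Prod.ext (by simp only; omega) rfl)
            · rw [if_neg hi, zero_mul]
          · intro hn
            rw [Finset.HasAntidiagonal.mem_antidiagonal] at hn
            simp only at hn
            omega
        · rw [Finset.sum_eq_zero]
          · split_ifs with h1 h2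
            · rw [zero_mul]
            · exact absurd ⟨h1, h2⟩ h
            · rfl
          · rintro ⟨i, j⟩ hij
            rw [Finset.HasAntidiagonal.mem_antidiagonal] at hij
            simp only at hij ⊢
            by_cases hi : a.degree = i + 1
            · rw [if_neg (c := b.degree = j), mul_zero]
              omega
            · rw [if_neg hi, zero_mul]
      rw [Finset.sum_comm, Finset.sum_congr rfl hs]
      split_ifs <;> simp

theorem frobeniusChar_UPFArea (n k : ℕ) :
    frobeniusChar (Representation.ofMulAction ℂ (Equiv.Perm (Fin n)) (UPFArea n k)) =
      ∑ c : Composition n with n - c.length = k, hList c.blocks := by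
  have : Finite (UPFArea n k) := Finite.of_fintype _
  ext m
  rw [coeff_frobeniusChar_ofMulAction]
  by_cases hk : k ≤ n
  · have hc : ∀ c : Composition n, n - c.length = k ↔ c.blocks.length = n - k := fun c => by
      have := c.length_le
      simp only [Composition.length] at this ⊢
      omega
    simp only [hc]
    rw [Finset.sum_filter, coeff_sum_hList]
    split_ifs with hm
    · rw [card_orbits (l := n - k) (by omega) hm, coeff_nontrivialMonomials_pow]
    · have : IsEmpty (Colouring n m) := ⟨fun f => hm (by rw [← f.2, degree_weight])⟩
      have : IsEmpty (MulAction.orbitRel.Quotient (Equiv.Perm (Fin n))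
          (UPFArea n k × Colouring n m)) := Quotient.instIsEmpty
      rw [Nat.card_of_isEmpty, Nat.cast_zero]
  -- For `k > n` both sides vanish, since neither an area nor `n - c.length` exceeds `n`.
  · have : IsEmpty (UPFArea n k) := ⟨fun α => hk (by rw [← α.2, area_eq α.1.2]; omega)⟩
    have : IsEmpty (MulAction.orbitRel.Quotient (Equiv.Perm (Fin n))
          (UPFArea n k × Colouring n m)) := Quotient.instIsEmpty
    rw [Nat.card_of_isEmpty, Nat.cast_zero, Finset.filter_false_of_mem, Finset.sum_empty, map_zero]
    intro c _
    omega

theorem gradedFrobenius_eq_sum_composition (n : ℕ) :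
    gradedFrobenius n = ∑ c : Composition n,
      Polynomial.X ^ (n - c.length) * Polynomial.C (hList c.blocks) := by
  rw [gradedFrobenius, ← Finset.sum_fiberwise_of_maps_to (s := Finset.univ)
    (t := Finset.range ((n + 1).choose 2 + 1)) (g := fun c : Composition n => n - c.length)]
  · refine Finset.sum_congr rfl fun k _ => ?_
    rw [frobeniusChar_UPFArea, map_sum, Finset.sum_mul]
    refine Finset.sum_congr rfl fun c hc => ?_
    rw [(Finset.mem_filter.1 hc).2, mul_comm]
  · intro c _
    rw [Finset.mem_range, Nat.choose_succ_succ' n 1, Nat.choose_one_right]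
    omega

/-! ### Weakly increasing parking functions and compositions. -/

theorem standardize_of_monotone {n : ℕ} {w : Fin n → ℕ} (hw : Monotone w) (i : Fin n) :
    standardize w i = i := by
  rw [standardize, show (Finset.univ.filter fun j => w j < w i ∨ (w j = w i ∧ j < i)) =
    Finset.Iio i from Finset.ext fun j => ?_, Fin.card_Iio]
  simp only [Finset.mem_filter, Finset.mem_univ, true_and, Finset.mem_Iio]
  constructor
  · rintro (h | h)
    · exact hw.reflect_lt h
    · exact h.2
  · intro h
    have := hw h.le
    omega

theorem monotone_fillBlocks {n : ℕ} {w : Fin n → ℕ} (hw : Monotone w) :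
    Monotone (fillBlocks w) := by
  intro i j hij
  rcases hij.eq_or_lt with rfl | hlt
  · exact le_rfl
  · rw [Fin.lt_def] at hlt
    simp only [fillBlocks, standardize_of_monotone hw, Fin.le_def]
    split_ifs <;> omega

theorem monotone_blockIndex {n : ℕ} {α : Fin n → Fin n} (h : Monotone α) :
    Monotone (blockIndex α) := by
  have hs : Tuple.sort α = Equiv.refl _ := Tuple.sort_eq_refl_iff_monotone.2 h
  intro i j hij
  have := blockIndex_mono α hij
  rwa [hs] at this

theorem eq_of_card_fiber_eq {n : ℕ} {b c : Fin n → ℕ} (hb : Monotone b) (hc : Monotone c)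
    (h : ∀ a, (Finset.univ.filter fun i => b i = a).card =
      (Finset.univ.filter fun i => c i = a).card) : b = c := by
  obtain ⟨σ, hσ⟩ := exists_perm_of_card_fiber_eq h
  have := Tuple.unique_monotone (f := c) (σ := σ) (τ := 1) (hσ ▸ hb) hc
  rw [hσ, this]
  rfl

theorem length_content {n : ℕ} (α : Fin n → Fin n) : (content α).length = numBlocks α := by
  simp [content]

theorem getElem_content {n : ℕ} (α : Fin n → Fin n) (j : ℕ) (hj : j < (content α).length) :
    (content α)[j] = (Finset.univ.filter fun i => blockIndex α i = j + 1).card := by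
  simp [content, add_comm]

/-- The block numbers of a weakly increasing function form a weakly increasing word, and such a word
is determined by its letter multiplicities, which the content lists. -/
theorem content_injective {n : ℕ} {α β : UPF n} (hα : Monotone α.1) (hβ : Monotone β.1)
    (h : content α.1 = content β.1) : α = β := by
  have hn : numBlocks α.1 = numBlocks β.1 := by rw [← length_content, h, length_content]
  refine blockIndex_injective (eq_of_card_fiber_eq (monotone_blockIndex hα)
    (monotone_blockIndex hβ) fun a => ?_)
  by_cases ha : a ∈ Finset.Icc 1 (numBlocks α.1)
  · obtain ⟨h1, h2⟩ := Finset.mem_Icc.1 ha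
    have e1 := getElem_content α.1 (a - 1) (by rw [length_content]; omega)
    have e2 := getElem_content β.1 (a - 1) (by rw [length_content]; omega)
    rw [Nat.sub_add_cancel h1] at e1 e2
    rw [← e1, ← e2]
    simp only [h]
  · have h0 : ∀ γ : UPF n, a ∉ Finset.Icc 1 (numBlocks γ.1) →
        (Finset.univ.filter fun i => blockIndex γ.1 i = a).card = 0 := by
      intro γ hγ
      rw [Finset.card_eq_zero, Finset.filter_eq_empty_iff]
      intro i _ hi
      rw [← image_blockIndex γ.2, ← hi] at hγ
      exact hγ (Finset.mem_image_of_mem _ (Finset.mem_univ i))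
    rw [h0 α ha, h0 β (hn ▸ ha)]

/-- The content of a unit interval parking function as a composition. -/
def contentComposition {n : ℕ} (α : UPF n) : Composition n where
  blocks := content α.1
  blocks_pos := by
    intro a ha
    obtain ⟨j, hj, rfl⟩ := List.getElem_of_mem ha
    rw [getElem_content, Finset.card_pos]
    have : j + 1 ∈ Finset.univ.image (blockIndex α.1) := by
      rw [length_content] at hj
      rw [image_blockIndex α.2, Finset.mem_Icc]
      omega
    obtain ⟨i, -, hi⟩ := Finset.mem_image.1 this
    exact ⟨i, by simpa using hi⟩
  blocks_sum := by
    have h := Finset.card_eq_sum_card_fiberwise (s := Finset.univ) (f := blockIndex α.1)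
      (t := Finset.Icc 1 (numBlocks α.1)) fun i _ => by
        rw [← image_blockIndex α.2]
        exact Finset.mem_coe.2 (Finset.mem_image_of_mem _ (Finset.mem_univ i))
    rw [Finset.card_univ, Fintype.card_fin] at h
    refine Eq.trans ?_ h.symm
    rw [content, ← List.sum_toFinset _ List.nodup_range']
    refine Finset.sum_congr (Finset.ext fun j => ?_) fun _ _ => rfl
    simp only [List.mem_toFinset, List.mem_range'_1, Finset.mem_Icc]
    omega

theorem length_contentComposition {n : ℕ} (α : UPF n) :
    (contentComposition α).length = numBlocks α.1 :=
  length_content α.1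

/-- The increasing word in which the letter `j` appears as often as the `j`-th part says. -/
def compositionWord {n : ℕ} (c : Composition n) (i : Fin n) : ℕ := c.index i + 1

theorem monotone_compositionWord {n : ℕ} (c : Composition n) : Monotone (compositionWord c) := by
  intro i j hij
  by_contra h
  simp only [compositionWord, not_le, Nat.add_lt_add_iff_right] at h
  -- If `j` lay in an earlier part than `i`, the end of that part would separate them and force `j <
  -- i`.
  have h1 := c.lt_sizeUpTo_index_succ j
  have h2 := c.sizeUpTo_index_le i
  have h3 := c.monotone_sizeUpTo (Nat.succ_le_of_lt h)
  rw [Fin.le_def] at hij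
  simp only [Fin.val_succ, Nat.succ_eq_add_one] at h1 h3
  omega

theorem card_compositionWord {n : ℕ} (c : Composition n) (j : Fin c.length) :
    (Finset.univ.filter fun i => compositionWord c i = j + 1).card = c.blocksFun j := by
  rw [← Fintype.card_fin (c.blocksFun j), ← Finset.card_univ]
  symm
  refine Finset.card_bij (fun i _ => c.embedding j i) ?_ ?_ ?_
  · intro i _
    rw [Finset.mem_filter, compositionWord, c.index_embedding]
    exact ⟨Finset.mem_univ _, rfl⟩
  · intro i _ k _ h
    exact (c.embedding j).injective h
  · intro i hi
    simp only [Finset.mem_filter, Finset.mem_univ, true_and, compositionWord,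
      Nat.add_right_cancel_iff] at hi
    obtain ⟨k, hk⟩ := c.mem_range_embedding_iff'.2 (Fin.ext hi).symm
    exact ⟨k, Finset.mem_univ _, hk⟩

theorem image_compositionWord {n : ℕ} (c : Composition n) :
    Finset.univ.image (compositionWord c) = Finset.Icc 1 c.length := by
  ext a
  simp only [Finset.mem_image, Finset.mem_univ, true_and, Finset.mem_Icc]
  constructor
  · rintro ⟨i, rfl⟩
    have := (c.index i).2
    simp only [compositionWord]
    omega
  · rintro ⟨h1, h2⟩
    let j : Fin c.length := ⟨a - 1, by omega⟩
    refine ⟨c.embedding j ⟨0, c.one_le_blocksFun j⟩, ?_⟩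
    rw [compositionWord, c.index_embedding]
    simp only [j]
    omega

theorem content_fillBlocks_compositionWord {n : ℕ} (c : Composition n) :
    content (fillBlocks (compositionWord c)) = c.blocks := by
  have hl : (content (fillBlocks (compositionWord c))).length = c.blocks.length := by
    rw [length_content, numBlocks_fillBlocks, image_compositionWord]
    simp [Composition.length]
  refine List.ext_getElem hl fun j h1 h2 => ?_
  rw [getElem_content, blockIndex_fillBlocks_of_image (image_compositionWord c)]
  exact card_compositionWord c ⟨j, h2⟩

-- Contents give the bijection; the inverse fills the increasing word whose letter multiplicities
-- are the parts.
open Classical in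
theorem sum_monotone_eq_sum_composition {M : Type*} [AddCommMonoid M] (n : ℕ)
    (F : ℕ → List ℕ → M) :
    ∑ α : UPF n with Monotone α.1, F (area α.1) (content α.1) =
      ∑ c : Composition n, F (n - c.length) c.blocks := by
  refine Finset.sum_bij (fun α _ => contentComposition α) (fun _ _ => Finset.mem_univ _) ?_ ?_ ?_
  · intro α hα β hβ h
    exact content_injective (Finset.mem_filter.1 hα).2 (Finset.mem_filter.1 hβ).2
      (congrArg Composition.blocks h)
  · intro c _
    exact ⟨⟨fillBlocks (compositionWord c), isUPF_fillBlocks _⟩,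
      Finset.mem_filter.2 ⟨Finset.mem_univ _, monotone_fillBlocks (monotone_compositionWord c)⟩,
      Composition.ext (content_fillBlocks_compositionWord c)⟩
  · intro α _
    rw [length_contentComposition, area_eq α.2]
    rfl

/-! ### The generating function. -/

/-- `UPF_{n+1}(x, t)`, sorted by the first part of the composition. -/
theorem toLaurent_gradedFrobenius_succ (n : ℕ) :
    Polynomial.toLaurent (gradedFrobenius (n + 1)) =
      ∑ p ∈ Finset.HasAntidiagonal.antidiagonal n,
        LaurentPolynomial.T p.1 * LaurentPolynomial.C (hSymm (p.1 + 1)) *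
          Polynomial.toLaurent (gradedFrobenius p.2) := by
  rw [gradedFrobenius_eq_sum_composition]
  rw [sum_composition_succ n fun L =>
    (Polynomial.X ^ (n + 1 - L.length) * Polynomial.C (hList L) : Series[X]), map_sum]
  refine Finset.sum_congr rfl fun p hp => ?_
  rw [gradedFrobenius_eq_sum_composition, map_sum, map_sum, Finset.mul_sum]
  refine Finset.sum_congr rfl fun c _ => ?_
  have h1 := c.length_le
  have h2 := Finset.HasAntidiagonal.mem_antidiagonal.1 hp
  -- A first part of size `p.1 + 1` contributes `p.1` to the exponent of `t`, one less than its
  -- size.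
  have h3 : n + 1 - ((p.1 + 1) :: c.blocks).length = p.1 + (p.2 - c.length) := by
    rw [List.length_cons]
    simp only [Composition.length] at h1 ⊢
    omega
  have h4 : hList ((p.1 + 1) :: c.blocks) = hSymm (p.1 + 1) * hList c.blocks := by simp [hList]
  rw [h3, h4]
  simp only [map_mul, Polynomial.toLaurent_C, Polynomial.toLaurent_X_pow, Nat.cast_add,
    LaurentPolynomial.T_add]
  ring

theorem hSymm_zero : hSymm 0 = 1 := by
  classical
  ext m
  rw [coeff_hSymm, MvPowerSeries.coeff_one]
  simp [Finsupp.degree_eq_zero_iff]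

theorem gradedFrobenius_zero : gradedFrobenius 0 = 1 := by
  have : ∀ c : Composition 0, c.blocks = [] := fun c =>
    List.length_eq_zero_iff.1 (Nat.le_zero.1 c.length_le)
  have hu : (Finset.univ : Finset (Composition 0)).card = 1 := by
    rw [Finset.card_univ, composition_card]
    rfl
  rw [gradedFrobenius_eq_sum_composition]
  simp [this, hList, hu]

theorem coeff_HSeriesTz (n : ℕ) : PowerSeries.coeff n HSeriesTz =
    LaurentPolynomial.T n * LaurentPolynomial.C (hSymm n) := by
  rw [HSeriesTz, PowerSeries.coeff_rescale, LaurentPolynomial.T_pow, HSeries, PowerSeries.coeff_mk,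
    mul_one]

theorem tNumber_two : tNumber 2 = 1 + tVar := by
  simp [tNumber, Finset.sum_range_succ]

theorem gradedFrobeniusSeries_mul :
    gradedFrobeniusSeries * (tNumber 2 - HSeriesTz) = tVar := by
  -- Multiplying the recursion by `t` supplies the missing power, so that a first part of size `k`
  -- carries `t ^ k h_k`, the coefficient of `z ^ k` in `H(tz)`. The denominator is `t - (H(tz) -
  -- 1)`, so this identity is the claim rearranged.
  have key : gradedFrobeniusSeries * tVar =
      tVar + (HSeriesTz - 1) * gradedFrobeniusSeries := by
    ext1 n
    rw [map_add, tVar, PowerSeries.coeff_mul_C, PowerSeries.coeff_mul, gradedFrobeniusSeries,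
      PowerSeries.coeff_mk, PowerSeries.coeff_C]
    cases n with
    | zero =>
      simp [gradedFrobenius_zero, coeff_HSeriesTz, hSymm_zero, PowerSeries.coeff_one]
    | succ n =>
      rw [if_neg n.succ_ne_zero, zero_add, Finset.Nat.antidiagonal_succ, Finset.sum_cons,
        Finset.sum_map, toLaurent_gradedFrobenius_succ, Finset.sum_mul]
      simp only [map_sub, coeff_HSeriesTz, hSymm_zero, PowerSeries.coeff_mk, PowerSeries.coeff_one,
        Nat.cast_zero, LaurentPolynomial.T_zero, map_one, mul_one, if_true, sub_self, zero_mul,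
        zero_add, Function.Embedding.prodMap, Function.Embedding.coeFn_mk, Prod.map,
        Nat.succ_ne_zero, Nat.succ_eq_add_one, Function.Embedding.refl_apply, if_false, sub_zero]
      refine Finset.sum_congr rfl fun p _ => ?_
      rw [Nat.cast_add, Nat.cast_one, LaurentPolynomial.T_add]
      ring
  rw [tNumber_two]
  linear_combination key

/-- The constant term in `z` is `(1 + t) - h_0 = t`, a unit among Laurent polynomials. -/
theorem isUnit_tNumber_two_sub_HSeriesTz : IsUnit (tNumber 2 - HSeriesTz) := by
  rw [PowerSeries.isUnit_iff_constantCoeff, ← PowerSeries.coeff_zero_eq_constantCoeff_apply,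
    map_sub, coeff_HSeriesTz, hSymm_zero, tNumber_two, tVar]
  simpa using LaurentPolynomial.isUnit_T 1

end UnitParking

open UnitParking Classical in
/-- `UPF_n(x, t)` is also the sum of `t ^ area(α) h_{con(α)}` over the weakly increasing unit
interval parking functions; its generating function is `t / ([2]_t - H(tz))`, the denominator being
invertible; and `UPF_n(x, t)` is the sum of `t ^ (n - ℓ(c)) h_c` over the compositions of `n`. -/
theorem mainTheorem10 :
    (∀ n : ℕ, gradedFrobenius n =
      ∑ α : UPF n with Monotone α.1,
        Polynomial.X ^ area α.1 * Polynomial.C (hList (content α.1))) ∧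
    IsUnit (tNumber 2 - HSeriesTz) ∧
    gradedFrobeniusSeries = tVar * Ring.inverse (tNumber 2 - HSeriesTz) ∧
    (∀ n : ℕ, gradedFrobenius n =
      ∑ c : Composition n,
        Polynomial.X ^ (n - c.length) * Polynomial.C (hList c.blocks)) := by
  refine ⟨fun n => ?_, isUnit_tNumber_two_sub_HSeriesTz, ?_, gradedFrobenius_eq_sum_composition⟩
  · rw [gradedFrobenius_eq_sum_composition]
    exact (sum_monotone_eq_sum_composition n fun k L =>
      (Polynomial.X ^ k * Polynomial.C (hList L) : Polynomial Series)).symm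
  -- `Ring.inverse` is 0 on non-units, so invertibility is what makes the quotient genuine.
  · exact Ring.eq_mul_inverse_iff_mul_eq _ _ _ isUnit_tNumber_two_sub_HSeriesTz |>.2
      gradedFrobeniusSeries_mul
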